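/- For $n\in\mathbb{N}$ let $\Omega_n=\dfrac{\pi^{n/2}}{\Gamma(1+n/2)}$ be the volume of the unit ball in the Euclidean space $\mathbb{R}^n$, and for $n\ge 2$ put $a_n=\Omega_n^{1/(n\ln n)}$. Then the sequence $(a_n)_{n\ge2}$ is strictly logarithmically convex, that is, $a_n>0$ and $a_{n+1}^2<a_n\,a_{n+2}$ for every integer $n\ge2$. Consequently, the sequence $$\frac{a_n}{a_{n+1}}=\frac{\Omega_n^{1/(n\ln n)}}{\Omega_{n+1}^{1/[(n+1)\ln(n+1)]}}$$ is strictly decreasing for $n\ge2$. -/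

import Mathlib

/-- The Lebesgue volume of the unit ball in the Euclidean space `ℝⁿ`. -/
noncomputable def unitBallVolume (n : ℕ) : ℝ :=
  MeasureTheory.volume.real (Metric.ball (0 : EuclideanSpace ℝ (Fin n)) 1)

/-- The closed form of the volume of the unit ball. -/
theorem unitBallVolume_eq (n : ℕ) :
    unitBallVolume n = Real.pi ^ ((n : ℝ) / 2) / Real.Gamma (1 + (n : ℝ) / 2) := by
  have hG : 0 < Real.Gamma ((n : ℝ) / 2 + 1) := Real.Gamma_pos_of_pos (by positivity)
  have h : Real.pi ^ ((n : ℝ) / 2) = √Real.pi ^ n := by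
    rw [Real.sqrt_eq_rpow, ← Real.rpow_natCast, ← Real.rpow_mul Real.pi_pos.le]
    congr 1
    ring
  rw [h, add_comm (1 : ℝ)]
  rcases Nat.eq_zero_or_pos n with rfl | hn
  · simp [unitBallVolume, MeasureTheory.measureReal_def,
      volume_euclideanSpace_eq_dirac]
  · have : Nonempty (Fin n) := ⟨⟨0, hn⟩⟩
    have hpos : 0 ≤ √Real.pi ^ n / Real.Gamma ((n : ℝ) / 2 + 1) := by positivity
    rw [unitBallVolume, MeasureTheory.measureReal_def, EuclideanSpace.volume_ball]
    simp [ENNReal.toReal_ofReal hpos]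

/-- The sequence `n ↦ Ωₙ ^ (1 / (n ln n))`, of interest for `n ≥ 2`. -/
noncomputable def unitBallSeq (n : ℕ) : ℝ :=
  unitBallVolume n ^ (1 / ((n : ℝ) * Real.log (n : ℝ)))

/-- The sequence `a N, a (N + 1), …` of reals is strictly logarithmically convex: its terms
are positive and `a (n + 1) ^ 2 < a n * a (n + 2)` for any three consecutive terms. -/
def StrictLogConvexFrom (N : ℕ) (a : ℕ → ℝ) : Prop :=
  (∀ n, N ≤ n → 0 < a n) ∧ ∀ n, N ≤ n → a (n + 1) ^ 2 < a n * a (n + 2)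

open Filter Topology

/-! Write g = `logVolume`; the claim is that g(n) / (n ln n) has positive second differences. The
recurrence from n to n + 2 yields a Stirling minorant S of g by induction. Log-convexity of Γ,
sharpened along the same recurrence, yields a Wallis-type upper bound for g(n+1) - g(n).

Put m = n + 1 and s = g(n) - S(n) ≥ 0. Then g(n+2) ≥ S(n+2) + s and 2 g(n+1) ≤ 2 (S(n+1) + s) + μ
with μ ≤ 1 / (m² - 1). The terms in s contribute s times a second difference of 1 / (x ln x), which
is nonnegative. What remains is `cleared_second_difference_pos`: the linear term of S contributes
order m ln m, against losses of order (ln m)³. -/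

theorem unitBallVolume_pos (n : ℕ) : 0 < unitBallVolume n := by
  rw [unitBallVolume_eq]
  have := Real.Gamma_pos_of_pos (show (0 : ℝ) < 1 + (n : ℝ) / 2 by positivity)
  have := Real.pi_pos
  positivity

/-! ### Recurrence and concavity of the log-volume -/

/-- The logarithm of the volume of the unit ball. -/
noncomputable def logVolume (n : ℕ) : ℝ := Real.log (unitBallVolume n)

theorem logVolume_eq (n : ℕ) :
    logVolume n = (n : ℝ) / 2 * Real.log Real.pi - Real.log (Real.Gamma (1 + (n : ℝ) / 2)) := by
  have := Real.Gamma_pos_of_pos (show (0 : ℝ) < 1 + (n : ℝ) / 2 by positivity)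
  have := Real.pi_pos
  rw [logVolume, unitBallVolume_eq, Real.log_div (by positivity) (by positivity),
    Real.log_rpow Real.pi_pos]

theorem logVolume_zero : logVolume 0 = 0 := by
  rw [logVolume_eq]
  simp

theorem logVolume_add_two (n : ℕ) :
    logVolume (n + 2) = logVolume n + Real.log (2 * Real.pi) - Real.log ((n : ℝ) + 2) := by
  have h := Real.Gamma_pos_of_pos (show (0 : ℝ) < 1 + (n : ℝ) / 2 by positivity)
  have e : (1 + ((n + 2 : ℕ) : ℝ) / 2) = (1 + (n : ℝ) / 2) + 1 := by push_cast; ring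
  have e2 : (1 + (n : ℝ) / 2) = ((n : ℝ) + 2) / 2 := by ring
  have hl : Real.log (1 + (n : ℝ) / 2) = Real.log ((n : ℝ) + 2) - Real.log 2 := by
    rw [e2, Real.log_div (by positivity) (by norm_num)]
  rw [logVolume_eq, logVolume_eq, e, Real.Gamma_add_one (by positivity),
    Real.log_mul (by positivity) h.ne', hl, Real.log_mul two_ne_zero Real.pi_ne_zero]
  push_cast
  ring

theorem logVolume_one : logVolume 1 = Real.log 2 := by
  have hp := Real.pi_pos
  have e : (1 + ((1 : ℕ) : ℝ) / 2) = 1 / 2 + 1 := by norm_num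
  rw [logVolume_eq, e, Real.Gamma_add_one (by norm_num), Real.Gamma_one_half_eq,
    Real.log_mul (by norm_num) (by positivity), Real.log_sqrt hp.le, one_div, Real.log_inv]
  push_cast
  ring

theorem logVolume_concave (n : ℕ) :
    logVolume n + logVolume (n + 2) ≤ 2 * logVolume (n + 1) := by
  have h := Real.convexOn_log_Gamma.2 (x := 1 + (n : ℝ) / 2) (y := 1 + ((n + 2 : ℕ) : ℝ) / 2)
    (show (0 : ℝ) < _ by positivity) (show (0 : ℝ) < _ by positivity)
    (show (0 : ℝ) ≤ 1 / 2 by norm_num) (show (0 : ℝ) ≤ 1 / 2 by norm_num) (by norm_num)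
  have e : (1 / 2 : ℝ) • (1 + (n : ℝ) / 2) + (1 / 2 : ℝ) • (1 + ((n + 2 : ℕ) : ℝ) / 2)
      = 1 + ((n + 1 : ℕ) : ℝ) / 2 := by
    simp only [smul_eq_mul]
    push_cast
    ring
  rw [e] at h
  simp only [smul_eq_mul, Function.comp] at h
  rw [logVolume_eq, logVolume_eq, logVolume_eq]
  push_cast at h ⊢
  linarith

/-- By concavity, twice an increment is at most the two-step increment ending at the same index,
which the recurrence evaluates. -/
theorem two_mul_logVolume_succ_sub_le_crude (n : ℕ) (hn : 1 ≤ n) :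
    2 * (logVolume (n + 1) - logVolume n) ≤ Real.log (2 * Real.pi) - Real.log ((n : ℝ) + 1) := by
  obtain ⟨k, rfl⟩ := Nat.exists_eq_add_of_le' hn
  have h1 := logVolume_concave k
  have h2 := logVolume_add_two k
  have e : ((k + 1 : ℕ) : ℝ) + 1 = (k : ℝ) + 2 := by push_cast; ring
  rw [e]
  linarith

/-! ### Wallis-type upper bound -/

/-- The defect in the Wallis-type inequality `(Ω (n + 1) / Ω n) ^ 2 ≤ 2 π / (n + 3 / 2)`. -/
noncomputable def wallisDefect (n : ℕ) : ℝ :=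
  2 * (logVolume (n + 1) - logVolume n) + Real.log ((n : ℝ) + 3 / 2) - Real.log (2 * Real.pi)

theorem wallisDefect_le_add_two (n : ℕ) : wallisDefect n ≤ wallisDefect (n + 2) := by
  have h1 := logVolume_add_two n
  have h2 := logVolume_add_two (n + 1)
  -- The shift 3/2 makes the two cubics agree except in the constant term, 13.5 against 14; no
  -- larger shift works for all n.
  have h3 : Real.log (((n : ℝ) + 3) ^ 2 * (n + 3 / 2)) ≤
      Real.log (((n : ℝ) + 2) ^ 2 * (n + 7 / 2)) := by
    apply Real.log_le_log (by positivity)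
    nlinarith
  rw [Real.log_mul (by positivity) (by positivity), Real.log_mul (by positivity) (by positivity),
    Real.log_pow, Real.log_pow] at h3
  have e1 : ((n + 2 : ℕ) : ℝ) + 3 / 2 = (n : ℝ) + 7 / 2 := by push_cast; ring
  have e2 : ((n + 1 : ℕ) : ℝ) + 2 = (n : ℝ) + 3 := by push_cast; ring
  have e3 : n + 2 + 1 = n + 1 + 2 := rfl
  rw [wallisDefect, wallisDefect, e1, e3, h1, h2, e2]
  push_cast at h3
  linarith

theorem wallisDefect_le_inv (n : ℕ) (hn : 1 ≤ n) : wallisDefect n ≤ 1 / (n : ℝ) := by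
  have h := two_mul_logVolume_succ_sub_le_crude n hn
  have hn' : (0 : ℝ) < n := by exact_mod_cast hn
  have h2 : Real.log (((n : ℝ) + 3 / 2) / (n + 1)) ≤ ((n : ℝ) + 3 / 2) / (n + 1) - 1 :=
    Real.log_le_sub_one_of_pos (by positivity)
  rw [Real.log_div (by positivity) (by positivity)] at h2
  have h3 : ((n : ℝ) + 3 / 2) / (n + 1) - 1 ≤ 1 / (n : ℝ) := by
    rw [div_sub_one (by positivity), div_le_div_iff₀ (by positivity) hn']
    linarith
  rw [wallisDefect]
  linarith

/-- The defect increases along steps of two, while the crude bound forces its upper limit to be at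
most 0. -/
theorem wallisDefect_nonpos (n : ℕ) : wallisDefect n ≤ 0 := by
  have hmono : ∀ j : ℕ, wallisDefect n ≤ wallisDefect (n + 2 * j) := by
    intro j
    induction j with
    | zero => simp
    | succ j ih => exact ih.trans (wallisDefect_le_add_two (n + 2 * j))
  refine ge_of_tendsto tendsto_one_div_add_atTop_nhds_zero_nat (Eventually.of_forall fun j => ?_)
  -- Taking j + 1 rather than j keeps the index positive when n = 0.
  refine (hmono (j + 1)).trans ((wallisDefect_le_inv _ (by omega)).trans ?_)
  apply one_div_le_one_div_of_le (by positivity)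
  push_cast
  have : (0 : ℝ) ≤ n := by positivity
  have : (0 : ℝ) ≤ j := by positivity
  linarith

theorem two_mul_logVolume_succ_le (n : ℕ) :
    2 * logVolume (n + 1) ≤
      2 * logVolume n + Real.log (2 * Real.pi) - Real.log ((n : ℝ) + 3 / 2) := by
  have := wallisDefect_nonpos n
  rw [wallisDefect] at this
  linarith

/-! ### Bounds for differences of logarithms -/

/-- The midpoint rule underestimates the integral of the convex function 1 / t over [x, x + 1]. -/
theorem two_div_le_log_sub {x : ℝ} (hx : 0 < x) :
    2 / (2 * x + 1) ≤ Real.log (x + 1) - Real.log x := by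
  have h := Real.le_log_one_add_of_nonneg (show 0 ≤ 1 / x by positivity)
  have e : 1 + 1 / x = (x + 1) / x := by field_simp
  rw [e, Real.log_div (by positivity) hx.ne'] at h
  refine le_trans (le_of_eq ?_) h
  field_simp
  ring

theorem log_sub_le_inv {x : ℝ} (hx : 0 < x) :
    Real.log (x + 1) - Real.log x ≤ 1 / x := by
  have h := Real.log_le_sub_one_of_pos (show 0 < (x + 1) / x by positivity)
  rw [Real.log_div (by positivity) hx.ne'] at h
  refine h.trans (le_of_eq ?_)
  field_simp
  ring

/-- The trapezoidal upper bound for `∫ 1 / t` over `[x, x + 1]`. -/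
theorem log_sub_le_trapezoid {x : ℝ} (hx : 0 < x) :
    Real.log (x + 1) - Real.log x ≤ (1 / x + 1 / (x + 1)) / 2 := by
  have hy : 0 < (x + 1) / x := by positivity
  have h0 : 0 ≤ Real.log ((x + 1) / x) := Real.log_nonneg (by rw [one_le_div hx]; linarith)
  -- For y = (x + 1) / x, sinh (ln y) = (y - 1/y) / 2 is exactly the trapezoidal value.
  have h := Real.self_le_sinh_iff.2 h0
  rw [Real.sinh_log hy, Real.log_div (by positivity) hx.ne'] at h
  refine h.trans (le_of_eq ?_)
  field_simp
  ring

/-! ### Stirling minorant -/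

/-- The linear coefficient in Stirling's approximation of `logVolume`. -/
noncomputable def stirlingSlope : ℝ := (Real.log (2 * Real.pi) + 1) / 2

/-- The constant term in the lower bound `stirlingMinorant` of `logVolume`. -/
noncomputable def stirlingConst : ℝ := 1 - Real.log 2 / 2

/-- A Stirling-type lower bound of `logVolume`. -/
noncomputable def stirlingMinorant (x : ℝ) : ℝ :=
  -(x * Real.log x) / 2 + stirlingSlope * x - Real.log x / 2 - stirlingConst

theorem stirlingSlope_ge : 1.4 ≤ stirlingSlope := by
  have h : (1.8 : ℝ) ≤ Real.log (2 * Real.pi) := by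
    rw [Real.le_log_iff_exp_le (by positivity)]
    -- Fifth powers make the exponent 1.8 an integer: e⁹ ≤ (2π)⁵.
    have h1 : Real.exp 1.8 ^ 5 ≤ (2 * Real.pi) ^ 5 := by
      calc Real.exp 1.8 ^ 5 = Real.exp 1 ^ 9 := by
            rw [← Real.exp_nat_mul, ← Real.exp_nat_mul]; norm_num
        _ ≤ 2.7182818286 ^ 9 := by
            gcongr
            exact Real.exp_one_lt_d9.le
        _ ≤ (2 * 3.14) ^ 5 := by norm_num
        _ ≤ (2 * Real.pi) ^ 5 := by
            gcongr
            exact Real.pi_gt_d2.le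
    exact le_of_pow_le_pow_left₀ (by norm_num) (by positivity) h1
  rw [stirlingSlope]
  linarith

theorem stirlingConst_nonneg : 0 ≤ stirlingConst := by
  have := Real.log_two_lt_d9
  rw [stirlingConst]
  linarith

theorem stirlingConst_le : stirlingConst ≤ 0.654 := by
  have := Real.log_two_gt_d9
  rw [stirlingConst]
  linarith

/-- After cancellation this says (x + 1) (ln (x + 2) - ln x) ≥ 2, which follows from two midpoint
bounds. -/
theorem stirlingMinorant_add_two_le {x : ℝ} (hx : 0 < x) :
    stirlingMinorant (x + 2) ≤
      stirlingMinorant x + Real.log (2 * Real.pi) - Real.log (x + 2) := by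
  have h1 := two_div_le_log_sub hx
  have h2 := two_div_le_log_sub (show 0 < x + 1 by linarith)
  rw [show x + 1 + 1 = x + 2 by ring] at h2
  have h3 : 2 / (x + 1) ≤ 2 / (2 * x + 1) + 2 / (2 * (x + 1) + 1) := by
    rw [div_add_div _ _ (by positivity) (by positivity),
      div_le_div_iff₀ (by positivity) (by positivity)]
    nlinarith
  have h4 : 2 ≤ (Real.log (x + 2) - Real.log x) * (x + 1) := by
    rw [← div_le_iff₀ (by positivity)]
    linarith
  simp only [stirlingMinorant, stirlingSlope]
  nlinarith

theorem stirlingMinorant_le_logVolume (n : ℕ) (hn : 2 ≤ n) :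
    stirlingMinorant n ≤ logVolume n := by
  induction n using Nat.strong_induction_on with
  | _ n ih =>
    have h2π : Real.log (2 * Real.pi) = Real.log 2 + Real.log Real.pi :=
      Real.log_mul two_ne_zero Real.pi_ne_zero
    obtain rfl | rfl | h4 : n = 2 ∨ n = 3 ∨ 4 ≤ n := by omega
    -- `stirlingConst` is the value giving equality at n = 2.
    · have h := logVolume_add_two 0
      rw [logVolume_zero, zero_add, h2π] at h
      rw [h]
      simp only [stirlingMinorant, stirlingSlope, stirlingConst, h2π]
      push_cast
      norm_num
      linarith
    · have h := logVolume_add_two 1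
      norm_num [logVolume_one, h2π] at h
      rw [h]
      -- The case n = 3 amounts to e π ≤ 9.
      have h9 : 1 + Real.log Real.pi ≤ 2 * Real.log 3 := by
        have e : 2 * Real.log 3 = Real.log 9 := by
          rw [show (9 : ℝ) = 3 ^ 2 by norm_num, Real.log_pow]
          norm_num
        rw [e, ← Real.log_exp 1, ← Real.log_mul (Real.exp_pos 1).ne' Real.pi_ne_zero]
        apply Real.log_le_log (by positivity)
        have h1 := Real.exp_one_lt_d9
        have h2 := Real.pi_lt_d2
        have h3 := Real.pi_pos
        have h4 := Real.exp_pos 1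
        nlinarith
      simp only [stirlingMinorant, stirlingSlope, stirlingConst, h2π]
      push_cast
      linarith
    · obtain ⟨k, rfl⟩ := Nat.exists_eq_add_of_le' (show 2 ≤ n by omega)
      have h1 := ih k (by omega) (by omega)
      have h2 := stirlingMinorant_add_two_le (show (0 : ℝ) < k by exact_mod_cast (by omega))
      rw [logVolume_add_two]
      push_cast
      linarith

/-! ### Positivity of the second difference -/

/-- On [1, ∞) the quotient (ln x)² / x peaks at x = e² with value 4 / e² < 0.5415; the bound comes
from ln t ≤ t - 1 at t = √x / e. -/
theorem log_sq_le {x : ℝ} (hx : 1 ≤ x) : Real.log x ^ 2 ≤ 0.5415 * x := by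
  have h0 : 0 < x := by linarith
  have hs : 0 < √x := Real.sqrt_pos.2 h0
  have he := Real.exp_one_gt_d9
  have hpos := Real.exp_pos 1
  have h1 := Real.log_le_sub_one_of_pos (show 0 < √x / Real.exp 1 by positivity)
  rw [Real.log_div hs.ne' hpos.ne', Real.log_exp, Real.log_sqrt h0.le] at h1
  have h2 : √x / Real.exp 1 ≤ √x / 2.7182818283 := by gcongr
  have h3 : Real.log x ≤ 2 * (√x / 2.7182818283) := by linarith
  have h4 : Real.log x ^ 2 ≤ (2 * (√x / 2.7182818283)) ^ 2 := by
    gcongr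
    exact Real.log_nonneg hx
  have h5 := Real.sq_sqrt h0.le
  have e : (2 * (√x / 2.7182818283)) ^ 2 = 4 / 2.7182818283 ^ 2 * √x ^ 2 := by ring
  rw [e, h5] at h4
  refine h4.trans ?_
  gcongr
  norm_num

/-- The elementary inequality behind the convexity, with denominators cleared. -/
theorem cleared_second_difference_pos {m L a b c k M : ℝ} (hm : 3 ≤ m) (hL : 0 < L)
    (hLm : L ≤ m) (hLsq : L ^ 2 ≤ 0.5415 * m) (haL : a < L) (hb : 0 ≤ b)
    (hab : 1 / m ^ 2 ≤ a * b) (hsub : 1 / m ^ 2 ≤ a - b) (ha' : a * (m - 1) ≤ 1)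
    (hb' : b * m ≤ 1) (hc : 1.4 ≤ c) (hk0 : 0 ≤ k) (hk : k ≤ 0.654) (hM : M ≤ 1) :
    0 < (m ^ 2 - 1) * (c * m - k) * ((a - b) * L + 2 * (a * b))
      - k * L * (2 * L + a * (m - 1) + b * (m + 1)) - (L - a) * (L + b) * (L + M) := by
  have hm0 : 0 < m := by linarith
  have h1 : 1.05 * m * (L + 2) ≤
      (m ^ 2 - 1) * (c * m - k) * ((a - b) * L + 2 * (a * b)) := by
    -- Both constants come from m ≥ 3: 8/9 = 1 - 1/9 and 1.182 = 1.4 - 0.654/3; their product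
    -- exceeds 1.05.
    have hA : 8 / 9 * m ^ 2 ≤ m ^ 2 - 1 := by nlinarith
    have hB : 1.182 * m ≤ c * m - k := by nlinarith
    have hC : 1 / m ^ 2 * (L + 2) ≤ (a - b) * L + 2 * (a * b) := by nlinarith
    calc 1.05 * m * (L + 2) ≤ (8 / 9 * 1.182) * m * (L + 2) := by gcongr; norm_num
      _ = (8 / 9 * m ^ 2) * (1.182 * m) * (1 / m ^ 2 * (L + 2)) := by field_simp
      _ ≤ _ :=
        have hA0 : 0 ≤ m ^ 2 - 1 := le_trans (by positivity) hA
        have hB0 : 0 ≤ c * m - k := le_trans (by positivity) hB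
        mul_le_mul (mul_le_mul hA hB (by positivity) hA0) hC (by positivity)
          (mul_nonneg hA0 hB0)
  have hb4 : b * (m + 1) ≤ 4 / 3 := by nlinarith
  have h2 : k * L * (2 * L + a * (m - 1) + b * (m + 1)) ≤ 0.654 * L * (2 * L + 7 / 3) := by
    have : 2 * L + a * (m - 1) + b * (m + 1) ≤ 2 * L + 7 / 3 := by linarith
    calc k * L * (2 * L + a * (m - 1) + b * (m + 1)) ≤ k * L * (2 * L + 7 / 3) := by gcongr
      _ ≤ _ := by gcongr
  have hsq : (L - a) * (L + b) ≤ L ^ 2 := by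
    have : 0 < 1 / m ^ 2 := by positivity
    nlinarith
  have h3 : (L - a) * (L + b) * (L + M) ≤ L ^ 2 * (L + 1) := by
    have h0 : 0 ≤ (L - a) * (L + b) := mul_nonneg (by linarith) (by linarith)
    calc (L - a) * (L + b) * (L + M) ≤ (L - a) * (L + b) * (L + 1) := by gcongr
      -- The inequality `hsq` drops the negative part of (L - a) (L + b) = L² - (a - b) L - a b.
      _ ≤ _ := by gcongr
  have h4 : L ^ 2 * L ≤ 0.5415 * m * L := by gcongr
  nlinarith

/-- AM-GM: 1/p + 1/q ≥ 2 / √(p q). It is used for the convexity of 1 / (x ln x). -/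
theorem two_div_le_inv_add_inv {p q r : ℝ} (hp : 0 < p) (hq : 0 < q) (hr : 0 < r)
    (h : p * q ≤ r ^ 2) : 2 / r ≤ 1 / p + 1 / q := by
  rw [div_add_div _ _ hp.ne' hq.ne', div_le_div_iff₀ hr (by positivity)]
  have h1 : (2 * (p * q)) ^ 2 ≤ ((1 * q + p * 1) * r) ^ 2 := by
    have : 0 < p * q := by positivity
    nlinarith [sq_nonneg (p - q), mul_nonneg (sq_nonneg (p - q)) (sq_nonneg r)]
  exact le_of_sq_le_sq h1 (by positivity)

set_option maxHeartbeats 800000 in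
theorem logVolume_second_difference (n : ℕ) (hn : 2 ≤ n) :
    2 * (logVolume (n + 1) / (((n : ℝ) + 1) * Real.log ((n : ℝ) + 1))) <
      logVolume n / ((n : ℝ) * Real.log n)
        + logVolume (n + 2) / (((n : ℝ) + 2) * Real.log ((n : ℝ) + 2)) := by
  have hn2 : (2 : ℝ) ≤ n := by exact_mod_cast hn
  have hs := stirlingMinorant_le_logVolume n hn
  have hmid := two_mul_logVolume_succ_le n
  have hend := logVolume_add_two n
  have hend' := stirlingMinorant_add_two_le (show (0 : ℝ) < n by linarith)
  obtain ⟨m, hm⟩ : ∃ m : ℝ, m = n + 1 := ⟨_, rfl⟩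
  have hn' : (n : ℝ) = m - 1 := by linarith
  rw [hn'] at hs hmid hend hend' ⊢
  rw [show m - 1 + 2 = m + 1 by ring] at hend hend' ⊢
  rw [show m - 1 + 1 = m by ring]
  rw [show m - 1 + 3 / 2 = m + 1 / 2 by ring] at hmid
  have hm3 : 3 ≤ m := by linarith
  have hm1 : 0 < m - 1 := by linarith
  have hm0 : 0 < m := by linarith
  have hc := stirlingSlope_ge
  have hk0 := stirlingConst_nonneg
  have hk := stirlingConst_le
  have hLn : 0 < Real.log (m - 1) := Real.log_pos (by linarith)
  have hL : 0 < Real.log m := Real.log_pos (by linarith)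
  have hLsq := log_sq_le (show 1 ≤ m by linarith)
  have hLm : Real.log m ≤ m := (Real.log_le_sub_one_of_pos hm0).trans (by linarith)
  have ha1 := two_div_le_log_sub hm1
  have ha2 := log_sub_le_inv hm1
  have ha3 := log_sub_le_trapezoid hm1
  have hb1 := two_div_le_log_sub hm0
  have hb2 := log_sub_le_inv hm0
  have hhalf : 1 / (2 * m + 1) ≤ Real.log (m + 1 / 2) - Real.log m := by
    have h := Real.one_sub_inv_le_log_of_pos (show 0 < (m + 1 / 2) / m by positivity)
    rw [Real.log_div (by positivity) hm0.ne'] at h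
    refine le_trans (le_of_eq ?_) h
    field_simp
    ring
  rw [show m - 1 + 1 = m by ring] at ha1 ha2 ha3
  have hsub : 1 / m ^ 2 ≤ (Real.log m - Real.log (m - 1)) - (Real.log (m + 1) - Real.log m) := by
    have h := Real.log_le_sub_one_of_pos
      (show 0 < (m - 1) * (m + 1) / m ^ 2 by positivity)
    rw [Real.log_div (by positivity) (by positivity), Real.log_mul (by positivity) (by positivity),
      Real.log_pow] at h
    have e : (m - 1) * (m + 1) / m ^ 2 - 1 = - (1 / m ^ 2) := by field_simp; ring
    rw [e] at h
    push_cast at h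
    linarith
  simp only [stirlingMinorant] at hs hend'
  have h2π : Real.log (2 * Real.pi) = 2 * stirlingSlope - 1 := by
    rw [stirlingSlope]; ring
  rw [h2π] at hmid hend hend'
  generalize stirlingSlope = c at *
  generalize stirlingConst = k at *
  generalize Real.log (m + 1 / 2) = H at *
  obtain ⟨a, ha⟩ : ∃ a, a = Real.log m - Real.log (m - 1) := ⟨_, rfl⟩
  obtain ⟨b, hb⟩ : ∃ b, b = Real.log (m + 1) - Real.log m := ⟨_, rfl⟩
  rw [← ha] at ha1 ha2 ha3 hsub
  rw [← hb] at hb1 hb2 hsub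
  have e1 : Real.log (m - 1) = Real.log m - a := by linarith
  have e2 : Real.log (m + 1) = Real.log m + b := by linarith
  rw [e1] at hs hend' hLn ⊢
  rw [e2] at hend hend' ⊢
  clear ha hb e1 e2 h2π
  generalize Real.log m = L at *
  generalize logVolume n = g0 at *
  generalize logVolume (n + 1) = g1 at *
  generalize logVolume (n + 2) = g2 at *
  clear hn hn2 hm hn'
  have hb0 : 0 < b := lt_of_lt_of_le (by positivity) hb1
  have ha0 : 0 < a := lt_of_lt_of_le (div_pos two_pos (by linarith)) ha1
  have hab : 1 / m ^ 2 ≤ a * b := by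
    have h1 : 2 / (2 * (m - 1) + 1) * (2 / (2 * m + 1)) ≤ a * b := by gcongr
    refine le_trans ?_ h1
    rw [div_mul_div_comm, div_le_div_iff₀ (by positivity) (mul_pos (by linarith) (by linarith))]
    nlinarith only [hm3]
  have ha' : a * (m - 1) ≤ 1 := by rwa [← le_div_iff₀ hm1]
  have hb' : b * m ≤ 1 := by rwa [← le_div_iff₀ hm0]
  -- μ is the excess over 2 (S(m) + s) in the Wallis bound for 2 g(m); the trapezoidal bound on a
  -- makes it O(1/m²).
  obtain ⟨μ, hμ⟩ : ∃ μ, μ = m * a - 1 + L - H := ⟨_, rfl⟩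
  have hM : μ * (m ^ 2 - 1) ≤ 1 := by
    have h1 : μ ≤ 3 / (2 * (m - 1) * (2 * m + 1)) := by
      have h2 : m * a ≤ m * ((1 / (m - 1) + 1 / m) / 2) := by gcongr
      have e : m * ((1 / (m - 1) + 1 / m) / 2) - 1 - 1 / (2 * m + 1)
          = 3 / (2 * (m - 1) * (2 * m + 1)) := by field_simp; ring
      linarith
    have h0 : 0 ≤ m ^ 2 - 1 := by nlinarith only [hm3]
    calc μ * (m ^ 2 - 1) ≤ 3 / (2 * (m - 1) * (2 * m + 1)) * (m ^ 2 - 1) := by gcongr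
      _ = 3 * (m + 1) / (2 * (2 * m + 1)) := by field_simp; ring
      _ ≤ 1 := by rw [div_le_one (by positivity)]; linarith
  have hcore := cleared_second_difference_pos hm3 hL hLm hLsq (by linarith) hb0.le hab hsub ha' hb'
    hc hk0 hk hM
  have hLb : 0 < L + b := by linarith
  have hp : 0 < (m - 1) * (L - a) := by positivity
  have hq : 0 < (m + 1) * (L + b) := by positivity
  have hr : 0 < m * L := by positivity
  have hB : 2 / (m * L) ≤ 1 / ((m - 1) * (L - a)) + 1 / ((m + 1) * (L + b)) := by
    apply two_div_le_inv_add_inv hp hq hr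
    have hsq : (L - a) * (L + b) ≤ L ^ 2 := by
      have : 0 < 1 / m ^ 2 := by positivity
      nlinarith only [this, hsub, hab, hL]
    have h0 : 0 ≤ (L - a) * (L + b) := by positivity
    calc (m - 1) * (L - a) * ((m + 1) * (L + b)) = (m ^ 2 - 1) * ((L - a) * (L + b)) := by ring
      _ ≤ m ^ 2 * L ^ 2 := by
        gcongr
        linarith
      _ = (m * L) ^ 2 := by ring
  -- s = g(n) - S(n); the recurrence carries this surplus to n + 2, and the Wallis bound carries it
  -- to n + 1 up to μ.
  obtain ⟨s, hs'⟩ : ∃ s, g0 = (-(m - 1) / 2 - 1 / 2) * (L - a) + c * (m - 1) - k + s :=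
    ⟨g0 - ((-(m - 1) / 2 - 1 / 2) * (L - a) + c * (m - 1) - k), by ring⟩
  have hs0 : 0 ≤ s := by linarith only [hs, hs']
  have hg2 : (-(m + 1) / 2 - 1 / 2) * (L + b) + c * (m + 1) - k + s ≤ g2 := by
    linarith only [hend, hend', hs']
  have hg1 : 2 * g1 ≤ 2 * ((-m / 2 - 1 / 2) * L + c * m - k + s) + μ := by
    linarith only [hμ, hmid, hs']
  have k1 : 2 * (g1 / (m * L)) ≤ (2 * ((-m / 2 - 1 / 2) * L + c * m - k + s) + μ) / (m * L) := by
    rw [← mul_div_assoc]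
    gcongr
  have k2 : ((-(m + 1) / 2 - 1 / 2) * (L + b) + c * (m + 1) - k + s) / ((m + 1) * (L + b)) ≤
      g2 / ((m + 1) * (L + b)) := by gcongr
  have hsB := mul_le_mul_of_nonneg_left hB hs0
  -- The second difference without its s-part, which is nonnegative by `hsB`, is the quantity in
  -- `hcore` over a positive denominator.
  have key : ((-(m - 1) / 2 - 1 / 2) * (L - a) + c * (m - 1) - k + s) / ((m - 1) * (L - a))
      + ((-(m + 1) / 2 - 1 / 2) * (L + b) + c * (m + 1) - k + s) / ((m + 1) * (L + b))
      - (2 * ((-m / 2 - 1 / 2) * L + c * m - k + s) + μ) / (m * L)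
      - (s * (1 / ((m - 1) * (L - a)) + 1 / ((m + 1) * (L + b))) - s * (2 / (m * L)))
      = ((m ^ 2 - 1) * (c * m - k) * ((a - b) * L + 2 * (a * b))
      - k * L * (2 * L + a * (m - 1) + b * (m + 1)) - (L - a) * (L + b) * (L + μ * (m ^ 2 - 1)))
        / (m * (m - 1) * (m + 1) * L * (L - a) * (L + b)) := by
    field_simp
    ring
  have hpos := div_pos hcore
    (show 0 < m * (m - 1) * (m + 1) * L * (L - a) * (L + b) by positivity)
  rw [← key] at hpos
  rw [hs']
  linarith only [hpos, k1, k2, hsB]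

/-! ### Return to the sequence itself -/

theorem unitBallSeq_pos (n : ℕ) : 0 < unitBallSeq n :=
  Real.rpow_pos_of_pos (unitBallVolume_pos n) _

theorem log_unitBallSeq (n : ℕ) :
    Real.log (unitBallSeq n) = logVolume n / ((n : ℝ) * Real.log n) := by
  rw [unitBallSeq, Real.log_rpow (unitBallVolume_pos n), logVolume]
  ring

theorem unitBallSeq_succ_sq_lt (n : ℕ) (hn : 2 ≤ n) :
    unitBallSeq (n + 1) ^ 2 < unitBallSeq n * unitBallSeq (n + 2) := by
  have h0 := unitBallSeq_pos n
  have h1 := unitBallSeq_pos (n + 1)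
  have h2 := unitBallSeq_pos (n + 2)
  rw [← Real.log_lt_log_iff (by positivity) (by positivity), Real.log_mul h0.ne' h2.ne',
    Real.log_pow, log_unitBallSeq, log_unitBallSeq, log_unitBallSeq]
  have h := logVolume_second_difference n hn
  push_cast
  exact h

theorem theorem2 :
    StrictLogConvexFrom 2 unitBallSeq ∧
      StrictAntiOn (fun n : ℕ => unitBallSeq n / unitBallSeq (n + 1)) (Set.Ici 2) := by
  refine ⟨⟨fun n _ => unitBallSeq_pos n, unitBallSeq_succ_sq_lt⟩, ?_⟩
  -- Shifting by 2 turns antitonicity on [2, ∞) into antitonicity on all of ℕ, where consecutive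
  -- terms suffice.
  have hanti : StrictAnti fun n : ℕ => unitBallSeq (n + 2) / unitBallSeq (n + 3) := by
    refine strictAnti_nat_of_succ_lt fun n => ?_
    rw [div_lt_div_iff₀ (unitBallSeq_pos _) (unitBallSeq_pos _), ← sq]
    exact unitBallSeq_succ_sq_lt (n + 2) (by omega)
  intro i hi j hj hij
  obtain ⟨i, rfl⟩ := Nat.exists_eq_add_of_le' (Set.mem_Ici.1 hi)
  obtain ⟨j, rfl⟩ := Nat.exists_eq_add_of_le' (Set.mem_Ici.1 hj)
  exact hanti (show i < j by omega)
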